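/- Let $n\ge 0$ be an integer. For a permutation $\sigma\in S_n$ let $P_\sigma$ be its permutation matrix ($P_\sigma(i,j)=1$ if $\sigma(i)=j$, and $0$ otherwise) and let $P^{[2]}_\sigma\in\mathbb{R}^{n^2\times n^2}$ be the matrix with entries $P^{[2]}_\sigma(ij,kl)=P_\sigma(i,j)P_\sigma(k,l)$. Let $\mathrm{QAP}_n=\mathrm{conv}\{P^{[2]}_\sigma : \sigma\in S_n\}$. A QAP4 inequality is an inequality $$\sum_{r=1}^{m}Y_{i_rj_r,i_rj_r}-\sum_{1\le r<s\le m}Y_{i_rj_r,i_sj_s}\le 1$$ in $Y\in\mathbb{R}^{n^2\times n^2}$, where $m\ge 7$, the indices $i_1,\dots,i_m\in[n]$ are distinct and the indices $j_1,\dots,j_m\in[n]$ are distinct (so $n\ge 7$). A bounded relaxation of $\mathrm{QAP}_n$ is a polytope (a bounded solution set of finitely many linear inequalities) $R\subset\mathbb{R}^{n^2\times n^2}$ with $\mathrm{QAP}_n\subseteq R$. The extension complexity $\mathrm{xc}(R)$ is the least number of facets of a polytope $Q\subset\mathbb{R}^{n^2\times n^2}\times\mathbb{R}^r$, $r\ge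 0$, with $R=\{x : \exists y,\ (x,y)\in Q\}$. If $R=\{x : A_ix\le b_i,\ i\in[p]\}=\mathrm{conv}\{v_1,\dots,v_t\}$ (redundant inequalities and points allowed), the matrix with entries $b_i-A_iv_j$ is called a slack matrix of $R$. Finally, let $N^1_n$ be the $2^n\times 2^n$ matrix with entries $N^1_n(a,b)=(a^{\top}b-1)(a^{\top}b-2)$, $a,b\in\{0,1\}^n$. (1) There are a constant $c>0$ and an integer $n_0$ such that for every $n\ge n_0$ and every bounded relaxation $R$ of $\mathrm{QAP}_n$ for which all QAP4 inequalities are valid, $\mathrm{xc}(R)\ge 2^{cn}$. (2) If exactly $q$ of the pairs $(i_r,j_r)$ of a QAP4 inequality satisfy $P_\sigma(i_r,j_r)=1$, then the slack of the inequality at $P^{[2]}_\sigma$ (the right-hand side minus the left-hand side) is $\binom{q-1}{2}=\frac{(q-1)(q-2)}{2}$ (so it is $1$ for $q=0$). (3) For every $n$ and every bounded relaxation $R$ of $\mathrm{QAP}_n$ for which all QAP4 inequalities are valid, some slack matrix of $R$ has as a submatrix the matrix $\frac12 N^1_n$ restricted to the rows $a$ with at least seven ones and to the columns $b$ whose number of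 zeros is not exactly one; the rows of this submatrix come from QAP4 inequalities and its columns from vertices $P^{[2]}_\sigma$ of $\mathrm{QAP}_n$. -/

import Mathlib

open scoped ENNReal

noncomputable section

section Polytopes

variable {E : Type*} [NormedAddCommGroup E] [NormedSpace ℝ E]

/-- A polytope: a bounded solution set of finitely many linear inequalities. -/
def IsPolytope (P : Set E) : Prop :=
  Bornology.IsBounded P ∧
    ∃ (p : ℕ) (A : Fin p → Module.Dual ℝ E) (b : Fin p → ℝ), P = {x | ∀ i, A i x ≤ b i}

/-- The dimension of a nonempty set: the dimension of the direction of its affine hull. -/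
def affDim (P : Set E) : ℕ := Module.finrank ℝ (vectorSpan ℝ P)

/-- A facet of `P`: a nonempty (exposed) face of dimension `dim P - 1`. -/
def IsFacet (P F : Set E) : Prop :=
  IsExposed ℝ P F ∧ F.Nonempty ∧ affDim F + 1 = affDim P

/-- The size of a polytope: its number of facets. -/
def polytopeSize (P : Set E) : ℕ∞ := {F : Set E | IsFacet P F}.encard

/-- `Q` is an extended formulation of `P` with `r` additional variables: a polytope
whose projection is `P`. -/
def IsExtension {r : ℕ} (Q : Set (E × (Fin r → ℝ))) (P : Set E) : Prop :=
  IsPolytope Q ∧ P = {x | ∃ y, (x, y) ∈ Q}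

/-- The extension complexity: the least number of facets of an extended formulation. -/
def extensionComplexity (P : Set E) : ℕ∞ :=
  ⨅ (r : ℕ) (Q : Set (E × (Fin r → ℝ))) (_ : IsExtension Q P), polytopeSize Q

/-- A description of `P` both by finitely many linear inequalities and as the convex hull of
finitely many points; redundant inequalities and points are allowed. -/
structure PolytopeDescription (P : Set E) where
  p : ℕ
  q : ℕ
  A : Fin p → Module.Dual ℝ E
  b : Fin p → ℝ
  v : Fin q → E
  eq_inequalities : P = {x | ∀ i, A i x ≤ b i}
  eq_convexHull : P = convexHull ℝ (Set.range v)

/-- The slack matrix of `P` with respect to a description of it. -/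
def PolytopeDescription.slackMatrix {P : Set E} (D : PolytopeDescription P) :
    Matrix (Fin D.p) (Fin D.q) ℝ :=
  Matrix.of fun i j => D.b i - D.A i (D.v j)

end Polytopes

/-- The space of real `n² × n²` matrices, rows and columns indexed by pairs;
`Y (i, j) (k, l)` is the entry `Y_{ij,kl}`. -/
abbrev QAPSpace (n : ℕ) : Type := Fin n × Fin n → Fin n × Fin n → ℝ

/-- The matrix `y yᵀ`, where `y` is the vectorized permutation matrix of `σ`. -/
def qapVertex {n : ℕ} (σ : Equiv.Perm (Fin n)) : QAPSpace n :=
  fun s t => σ.permMatrix ℝ s.1 s.2 * σ.permMatrix ℝ t.1 t.2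

/-- The QAP-polytope. -/
def qapPolytope (n : ℕ) : Set (QAPSpace n) :=
  convexHull ℝ (Set.range (qapVertex (n := n)))

/-- The data of a QAP4 inequality: `m ≥ 7`, distinct `i_1, …, i_m` and distinct `j_1, …, j_m`
(so that `n ≥ 7` as well). -/
structure QAP4 (n : ℕ) where
  m : ℕ
  seven_le : 7 ≤ m
  i : Fin m ↪ Fin n
  j : Fin m ↪ Fin n

namespace QAP4

variable {n : ℕ}

/-- The left-hand side `∑_r Y_{i_r j_r, i_r j_r} - ∑_{r < s} Y_{i_r j_r, i_s j_s}`. -/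
def lhs (h : QAP4 n) (Y : QAPSpace n) : ℝ :=
  ∑ r, Y (h.i r, h.j r) (h.i r, h.j r) -
    ∑ r, ∑ s ∈ Finset.Ioi r, Y (h.i r, h.j r) (h.i s, h.j s)

/-- The inequality `lhs ≤ 1` holds on all of `R`. -/
def ValidOn (h : QAP4 n) (R : Set (QAPSpace n)) : Prop := ∀ Y ∈ R, h.lhs Y ≤ 1

/-- The slack of the inequality `lhs ≤ 1` at `Y`. -/
def slack (h : QAP4 n) (Y : QAPSpace n) : ℝ := 1 - h.lhs Y

/-- The number of `r` with `P_σ(i_r, j_r) = 1`. -/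
def hits (h : QAP4 n) (σ : Equiv.Perm (Fin n)) : ℕ :=
  (Finset.univ.filter fun r => σ (h.i r) = h.j r).card

end QAP4

/-- A bounded relaxation of the QAP-polytope (a polytope containing it) for which all
QAP4 inequalities are valid. -/
def IsQAP4Relaxation {n : ℕ} (R : Set (QAPSpace n)) : Prop :=
  IsPolytope R ∧ qapPolytope n ⊆ R ∧ ∀ h : QAP4 n, h.ValidOn R

/-- The matrix `N^k_n`, with entry `(aᵀb - k)(aᵀb - k - 1)` for `a, b ∈ {0,1}^n`. -/
def Nmat (k n : ℕ) : Matrix (Fin n → Fin 2) (Fin n → Fin 2) ℝ :=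
  Matrix.of fun a b =>
    ((∑ i, ((a i : ℕ) : ℝ) * ((b i : ℕ) : ℝ)) - k) *
      ((∑ i, ((a i : ℕ) : ℝ) * ((b i : ℕ) : ℝ)) - k - 1)

/-- The 0/1 vectors with at least seven ones. -/
abbrev RowVec (n : ℕ) : Type :=
  {a : Fin n → Fin 2 // 7 ≤ (Finset.univ.filter fun i => a i = 1).card}

/-- The 0/1 vectors whose number of zeros is not exactly one. -/
abbrev ColVec (n : ℕ) : Type :=
  {b : Fin n → Fin 2 // (Finset.univ.filter fun i => b i = 0).card ≠ 1}

end

/-! With the index pairs `(i, i)`, `i ∈ S`, a QAP4 inequality has slack `(q - 1)(q - 2) / 2` at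
`qapVertex σ`, where `q = #(S ∩ B)` and `B` is the fixed-point set of `σ` (`QAP4.slack_diag`). Every
`B` whose complement is not a single point occurs, so appending these inequalities and vertices to a
description of `R` yields part (3).

For part (1), the slack is positive on disjoint pairs and zero on pairs meeting once. In an
extension `Q`, each facet `F` gives a rectangle: the sets `A` whose face of `Q` lies in `F`, times
the sets `B` whose vertex has a lift outside `F`. No rectangle contains a pair meeting once, and
together they cover all disjoint pairs (`exists_isFacet_of_lt`). On `m` elements there are `3 ^ m`
disjoint pairs, at most `2 ^ m` of them in one rectangle (`disjointPairs_le`), so `Q` has at least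
`(3 / 2) ^ m` facets. -/

/-! ### Rectangle covers of the disjoint pairs. -/

/-- The number of disjoint pairs of subsets of `U` whose first member satisfies `P` and whose
second member satisfies `Q`. -/
def disjointPairs {α : Type*} [DecidableEq α] (U : Finset α) (P Q : Finset α → Prop)
    [DecidablePred P] [DecidablePred Q] : ℕ :=
  ∑ A ∈ U.powerset, ∑ B ∈ U.powerset, if P A ∧ Q B ∧ Disjoint A B then 1 else 0

/-- In a disjoint pair, `x` lies in neither set, only in the second, or only in the first. -/
lemma disjointPairs_insert {α : Type*} [DecidableEq α] {U : Finset α} {x : α} (hx : x ∉ U)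
    (P Q : Finset α → Prop) [DecidablePred P] [DecidablePred Q] :
    disjointPairs (insert x U) P Q = ∑ A ∈ U.powerset, ∑ B ∈ U.powerset,
      ((if P A ∧ Q B ∧ Disjoint A B then 1 else 0) +
        (if P A ∧ Q (insert x B) ∧ Disjoint A B then 1 else 0) +
        (if P (insert x A) ∧ Q B ∧ Disjoint A B then 1 else 0)) := by
  rw [disjointPairs, Finset.sum_powerset_insert hx, ← Finset.sum_add_distrib]
  refine Finset.sum_congr rfl fun A hA => ?_
  rw [Finset.sum_powerset_insert hx, Finset.sum_powerset_insert hx]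
  simp only [← Finset.sum_add_distrib]
  refine Finset.sum_congr rfl fun B hB => ?_
  have h1 : x ∉ A := fun h => hx (Finset.mem_powerset.1 hA h)
  have h2 : x ∉ B := fun h => hx (Finset.mem_powerset.1 hB h)
  simp [Finset.disjoint_insert_left, Finset.disjoint_insert_right, h1, h2]

lemma disjointPairs_true {α : Type*} [DecidableEq α] (U : Finset α) :
    disjointPairs U (fun _ => True) (fun _ => True) = 3 ^ U.card := by
  induction U using Finset.induction_on with
  | empty => simp [disjointPairs]
  | insert x U hx ih =>
    rw [disjointPairs_insert hx, Finset.card_insert_of_notMem hx, pow_succ, ← ih, disjointPairs]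
    simp only [true_and, Finset.sum_add_distrib]
    ring

/-- The Kaibel–Weltge bound: a rectangle without pairs meeting in exactly one element has at
most `2 ^ #U` disjoint pairs. -/
lemma disjointPairs_le {α : Type*} [DecidableEq α] (U : Finset α) (P Q : Finset α → Prop)
    [DecidablePred P] [DecidablePred Q]
    (h : ∀ A ⊆ U, ∀ B ⊆ U, P A → Q B → (A ∩ B).card ≠ 1) :
    disjointPairs U P Q ≤ 2 ^ U.card := by
  induction U using Finset.induction_on generalizing P Q with
  | empty => simp only [disjointPairs, Finset.powerset_empty, Finset.sum_singleton]; split <;> simp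
  | insert x U hx ih =>
    -- Both rectangles on `U` inherit the hypothesis: adding `x` to only one member of a pair does
    -- not change the intersection.
    have e1 := ih (fun A => P A ∨ P (insert x A)) Q (by
      intro A hA B hB hP hQ
      have hxB : x ∉ B := fun h => hx (hB h)
      rcases hP with hP | hP
      · exact h A (hA.trans (Finset.subset_insert _ _)) B (hB.trans (Finset.subset_insert _ _)) hP hQ
      · have := h _ (Finset.insert_subset_insert x hA) B (hB.trans (Finset.subset_insert _ _)) hP hQ
        rwa [Finset.insert_inter_of_notMem hxB] at this)
    have e2 := ih P (fun B => Q B ∨ Q (insert x B)) (by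
      intro A hA B hB hP hQ
      have hxA : x ∉ A := fun h => hx (hA h)
      rcases hQ with hQ | hQ
      · exact h A (hA.trans (Finset.subset_insert _ _)) B (hB.trans (Finset.subset_insert _ _)) hP hQ
      · have := h A (hA.trans (Finset.subset_insert _ _)) _ (Finset.insert_subset_insert x hB) hP hQ
        rwa [Finset.inter_insert_of_notMem hxA] at this)
    have key : disjointPairs (insert x U) P Q ≤
        disjointPairs U (fun A => P A ∨ P (insert x A)) Q +
          disjointPairs U P (fun B => Q B ∨ Q (insert x B)) := by
      rw [disjointPairs_insert hx, disjointPairs, disjointPairs, ← Finset.sum_add_distrib]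
      refine Finset.sum_le_sum fun A hA => ?_
      rw [← Finset.sum_add_distrib]
      refine Finset.sum_le_sum fun B hB => ?_
      rw [Finset.mem_powerset] at hA hB
      by_cases hd : Disjoint A B
      -- The sets `insert x A` and `insert x B` would meet in `x` alone. Hence at most two of the
      -- three extensions of `(A, B)` count, and the two smaller rectangles pay for them.
      · have h11 : ¬ (P (insert x A) ∧ Q (insert x B)) := by
          rintro ⟨hP, hQ⟩
          apply h _ (Finset.insert_subset_insert x hA) _ (Finset.insert_subset_insert x hB) hP hQ
          rw [← Finset.insert_inter_distrib, Finset.disjoint_iff_inter_eq_empty.1 hd]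
          simp
        by_cases c : P (insert x A)
        · have d : ¬ Q (insert x B) := fun d => h11 ⟨c, d⟩
          by_cases a : P A <;> by_cases b : Q B <;> simp [a, b, c, d, hd]
        · by_cases a : P A <;> by_cases b : Q B <;> by_cases d : Q (insert x B) <;>
            simp [a, b, c, d, hd]
      · simp [hd]
    rw [Finset.card_insert_of_notMem hx, pow_succ]
    omega

/-- Rectangles without pairs meeting in exactly one element that cover all disjoint pairs of
subsets of `U` number at least `(3 / 2) ^ #U`. -/
lemma three_pow_le_card_mul_two_pow {α ι : Type*} [DecidableEq α] (U : Finset α) (s : Finset ι)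
    (P Q : ι → Finset α → Prop)
    (h : ∀ i ∈ s, ∀ A ⊆ U, ∀ B ⊆ U, P i A → Q i B → (A ∩ B).card ≠ 1)
    (hcov : ∀ A ⊆ U, ∀ B ⊆ U, Disjoint A B → ∃ i ∈ s, P i A ∧ Q i B) :
    3 ^ U.card ≤ s.card * 2 ^ U.card := by
  classical
  calc 3 ^ U.card = disjointPairs U (fun _ => True) (fun _ => True) := (disjointPairs_true U).symm
    _ ≤ ∑ i ∈ s, disjointPairs U (P i) (Q i) := by
        simp only [disjointPairs]
        rw [Finset.sum_comm (s := s)]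
        refine Finset.sum_le_sum fun A hA => ?_
        rw [Finset.sum_comm (s := s)]
        refine Finset.sum_le_sum fun B hB => ?_
        rw [Finset.mem_powerset] at hA hB
        by_cases hd : Disjoint A B
        · obtain ⟨i, hi, hP, hQ⟩ := hcov A hA B hB hd
          refine le_trans ?_ (Finset.single_le_sum (fun _ _ => Nat.zero_le _) hi)
          simp [hd, hP, hQ]
        · simp [hd]
    _ ≤ ∑ i ∈ s, 2 ^ U.card := Finset.sum_le_sum fun i hi => disjointPairs_le U _ _ (h i hi)
    _ = _ := by simp

/-! ### Slacks of QAP4 inequalities at vertices. -/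

lemma two_mul_choose_two (z : ℤ) : 2 * Ring.choose z 2 = z * (z - 1) := by
  have := Ring.descPochhammer_eq_factorial_smul_choose z 2
  simp [descPochhammer_succ_right, Polynomial.smeval_mul, Polynomial.smeval_sub,
    Polynomial.smeval_X, Polynomial.smeval_one, Nat.factorial] at this
  linarith

lemma two_mul_sum_sum_Ioi_mul {m : ℕ} (x : Fin m → ℝ) :
    2 * ∑ r, ∑ s ∈ Finset.Ioi r, x r * x s = (∑ r, x r) ^ 2 - ∑ r, x r * x r := by
  have h := Finset.sum_sum_Ioi_add_eq_sum_sum_off_diag fun r s => x r * x s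
  have h1 : ∑ r, ∑ s ∈ Finset.Ioi r, (x s * x r + x r * x s)
      = 2 * ∑ r, ∑ s ∈ Finset.Ioi r, x r * x s := by
    simp only [Finset.mul_sum]
    exact Finset.sum_congr rfl fun r _ => Finset.sum_congr rfl fun s _ => by ring
  rw [← h1, h, sq, Finset.sum_mul_sum, ← Finset.sum_sub_distrib]
  refine Finset.sum_congr rfl fun r _ => ?_
  rw [← Finset.sum_add_sum_compl {r} fun s => x r * x s]
  simp [mul_comm]

namespace QAP4

variable {n : ℕ}

/-- The slack of a QAP4 inequality at a vertex, as a real number. -/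
lemma slack_qapVertex (h : QAP4 n) (σ : Equiv.Perm (Fin n)) :
    h.slack (qapVertex σ) = ((h.hits σ : ℝ) - 1) * ((h.hits σ : ℝ) - 2) / 2 := by
  set x : Fin h.m → ℝ := fun r => if σ (h.i r) = h.j r then 1 else 0 with hx
  have hv : ∀ r s, qapVertex σ (h.i r, h.j r) (h.i s, h.j s) = x r * x s := by
    intro r s
    simp [qapVertex, hx, PEquiv.toMatrix_apply, Equiv.toPEquiv_apply]
  have hq : ∑ r, x r = h.hits σ := by simp [hx, hits]
  have hq' : ∑ r, x r * x r = h.hits σ := by rw [← hq]; exact Finset.sum_congr rfl fun r _ => by simp only [hx]; split <;> simp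
  have h2 := two_mul_sum_sum_Ioi_mul x
  simp only [slack, lhs, hv]
  rw [hq'] at h2 ⊢
  rw [hq] at h2
  linarith

/-- The binomial is taken over `ℤ`, so that `q = 0` gives `choose (-1) 2 = 1`; truncated subtraction
would give `0`. -/
lemma slack_qapVertex_eq_choose (h : QAP4 n) (σ : Equiv.Perm (Fin n)) :
    h.slack (qapVertex σ) = ((Ring.choose ((h.hits σ : ℤ) - 1) 2 : ℤ) : ℝ) := by
  have h2 : (2 : ℝ) * ((Ring.choose ((h.hits σ : ℤ) - 1) 2 : ℤ) : ℝ)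
      = ((h.hits σ : ℝ) - 1) * ((h.hits σ : ℝ) - 1 - 1) := by
    exact_mod_cast two_mul_choose_two ((h.hits σ : ℤ) - 1)
  rw [slack_qapVertex]
  linarith

/-- The left-hand side of a QAP4 inequality as a linear functional. -/
def lhsLinear (h : QAP4 n) : Module.Dual ℝ (QAPSpace n) where
  toFun := h.lhs
  map_add' X Y := by
    simp only [lhs, Pi.add_apply, Finset.sum_add_distrib]
    ring
  map_smul' c X := by
    simp only [lhs, Pi.smul_apply, smul_eq_mul, ← Finset.mul_sum, RingHom.id_apply]
    ring

/-- The QAP4 inequality with the index pairs `(i, i)`, `i ∈ S`. -/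
def diag (S : Finset (Fin n)) (hS : 7 ≤ S.card) : QAP4 n where
  m := S.card
  seven_le := hS
  i := (S.orderEmbOfFin rfl).toEmbedding
  j := (S.orderEmbOfFin rfl).toEmbedding

lemma hits_diag (S : Finset (Fin n)) (hS : 7 ≤ S.card) (σ : Equiv.Perm (Fin n)) :
    (diag S hS).hits σ = (S.filter fun x => σ x = x).card := by
  rw [hits, ← Finset.card_map (diag S hS).i]
  congr 1
  ext x
  constructor
  · intro hx
    obtain ⟨r, hr, rfl⟩ := Finset.mem_map.1 hx
    exact Finset.mem_filter.2 ⟨S.orderEmbOfFin_mem rfl r, (Finset.mem_filter.1 hr).2⟩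
  · intro hx
    obtain ⟨hxS, hσ⟩ := Finset.mem_filter.1 hx
    rw [← Finset.mem_coe, ← Finset.range_orderEmbOfFin S rfl] at hxS
    obtain ⟨r, rfl⟩ := hxS
    exact Finset.mem_map.2 ⟨r, Finset.mem_filter.2 ⟨Finset.mem_univ _, hσ⟩, rfl⟩

end QAP4

lemma QAP4.slack_diag {n : ℕ} (S B : Finset (Fin n)) (hS : 7 ≤ S.card) {σ : Equiv.Perm (Fin n)}
    (hσ : ∀ x, σ x = x ↔ x ∈ B) : (diag S hS).slack (qapVertex σ) =
      (((S ∩ B).card : ℝ) - 1) * (((S ∩ B).card : ℝ) - 2) / 2 := by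
  simp only [slack_qapVertex, hits_diag, hσ, Finset.filter_mem_eq_inter]

/-- A set whose complement does not have exactly one element is the set of fixed points of some
permutation. -/
lemma exists_perm_fixedPoints {α : Type*} [Fintype α] [DecidableEq α] (B : Finset α)
    (hB : Bᶜ.card ≠ 1) : ∃ σ : Equiv.Perm α, ∀ x, σ x = x ↔ x ∈ B := by
  -- A single cycle through all of `Bᶜ` moves each of its points, unless `Bᶜ` is a singleton.
  obtain ⟨σ, hc, hs⟩ := Finset.exists_cycleOn Bᶜ
  refine ⟨σ, fun x => ⟨fun hx => ?_, fun hx => ?_⟩⟩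
  · by_contra hxB
    have hxB' : x ∈ Bᶜ := Finset.mem_compl.2 hxB
    have hlt : 1 < Bᶜ.card := by
      have := Finset.card_pos.2 ⟨x, hxB'⟩
      omega
    exact hc.apply_ne (Finset.one_lt_card_iff_nontrivial.1 hlt) hxB' hx
  · by_contra h
    exact Finset.mem_compl.1 (hs (Equiv.Perm.mem_support.2 h)) hx

/-! ### Extreme points and facets of polyhedra. -/

section Polyhedra

variable {E : Type*} [NormedAddCommGroup E] [NormedSpace ℝ E]

/-- Finitely many inequalities along a ray, the tight ones not increasing, persist for a short time. -/
lemma exists_pos_forall_add_mul_le {ι : Type*} (s : Finset ι) (a c b : ι → ℝ)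
    (h : ∀ i ∈ s, a i ≤ b i ∧ (a i = b i → c i ≤ 0)) :
    ∃ ε : ℝ, 0 < ε ∧ ∀ i ∈ s, a i + ε * c i ≤ b i := by
  have key : ∀ᶠ ε in nhdsWithin (0 : ℝ) (Set.Ioi 0), ∀ i ∈ s, a i + ε * c i ≤ b i := by
    rw [Filter.eventually_all_finset]
    intro i hi
    obtain ⟨hab, hc⟩ := h i hi
    rcases hab.lt_or_eq with hlt | heq
    · have ht : Filter.Tendsto (fun ε : ℝ => a i + ε * c i) (nhdsWithin 0 (Set.Ioi 0))
          (nhds (a i)) := by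
        have : Continuous fun ε : ℝ => a i + ε * c i := by fun_prop
        simpa using (this.tendsto 0).mono_left nhdsWithin_le_nhds
      exact (ht.eventually_lt_const hlt).mono fun _ h => h.le
    · filter_upwards [self_mem_nhdsWithin] with ε hε
      have := mul_nonpos_of_nonneg_of_nonpos (le_of_lt hε) (hc heq)
      linarith
  obtain ⟨ε, h1, h2⟩ := (key.and self_mem_nhdsWithin).exists
  exact ⟨ε, h2, h1⟩

/-- A polyhedron has finitely many extreme points: each is determined by its tight inequalities. -/
lemma extremePoints_polyhedron_finite {p : ℕ} (A : Fin p → Module.Dual ℝ E) (b : Fin p → ℝ) :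
    (Set.extremePoints ℝ {x | ∀ i, A i x ≤ b i}).Finite := by
  refine Set.Finite.of_injOn (f := fun x => {i | A i x = b i}) (t := Set.univ)
    (Set.mapsTo_univ _ _) ?_ Set.finite_univ
  intro x hx y hy hxy
  -- Inequalities tight at `x` are also tight at `y`, so one can move from `x` slightly away from
  -- `y`. Then `x` lies between two points of the polyhedron, and extremality forces `x = y`.
  obtain ⟨ε, hε, h⟩ := exists_pos_forall_add_mul_le Finset.univ (fun i => A i x)
    (fun i => A i x - A i y) b fun i _ => ⟨hx.1 i, fun hi => by
      have : A i y = b i := (Set.ext_iff.1 hxy i).1 hi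
      linarith⟩
  have hmem : x + ε • (x - y) ∈ {x | ∀ i, A i x ≤ b i} := fun i => by
    simpa using h i (Finset.mem_univ i)
  have hseg : x ∈ openSegment ℝ (x + ε • (x - y)) y := by
    refine ⟨1 / (1 + ε), ε / (1 + ε), by positivity, by positivity, by field_simp, ?_⟩
    have : (1 + ε) ≠ 0 := by positivity
    match_scalars <;> field_simp
    ring
  exact (mem_extremePoints.1 hx).2 _ hmem _ hy.1 hseg |>.2.symm

/-- A polytope is the convex hull of finitely many points. -/
lemma IsPolytope.exists_eq_convexHull [FiniteDimensional ℝ E] {R : Set E} (hR : IsPolytope R) :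
    ∃ (q : ℕ) (v : Fin q → E), R = convexHull ℝ (Set.range v) := by
  obtain ⟨hb, p, A, b, rfl⟩ := hR
  have hfin := extremePoints_polyhedron_finite A b
  have hclosed : IsClosed {x | ∀ i, A i x ≤ b i} := by
    simp only [Set.ofPred_forall]
    exact isClosed_iInter fun i =>
      isClosed_le (LinearMap.continuous_of_finiteDimensional (A i)) continuous_const
  have hconv : Convex ℝ {x | ∀ i, A i x ≤ b i} := by
    simp only [Set.ofPred_forall]
    exact convex_iInter fun i => convex_halfSpace_le (A i).isLinear (b i)
  have hproper : ProperSpace E := FiniteDimensional.proper_real E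
  have hcomp := Metric.isCompact_of_isClosed_isBounded hclosed hb
  have h := closure_convexHull_extremePoints hcomp hconv
  rw [(hfin.isClosed_convexHull ℝ).closure_eq] at h
  have := hfin.to_subtype
  obtain ⟨q, ⟨e⟩⟩ := Finite.exists_equiv_fin (Set.extremePoints ℝ {x | ∀ i, A i x ≤ b i})
  refine ⟨q, fun i => (e.symm i : E), ?_⟩
  have hr : Set.range (fun i => (e.symm i : E)) = Set.extremePoints ℝ {x | ∀ i, A i x ≤ b i} := by
    exact (e.symm.surjective.range_comp Subtype.val).trans Subtype.range_coe
  rw [hr, h]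

/-- A polyhedron has, relative to its affine hull, an irredundant subsystem. -/
lemma exists_irredundant {p : ℕ} (A : Fin p → Module.Dual ℝ E) (b : Fin p → ℝ) :
    ∃ J : Finset (Fin p),
      (∀ x ∈ affineSpan ℝ {x | ∀ i, A i x ≤ b i}, (∀ j ∈ J, A j x ≤ b j) → ∀ i, A i x ≤ b i) ∧
      ∀ j ∈ J, ∃ y ∈ affineSpan ℝ {x | ∀ i, A i x ≤ b i},
        b j < A j y ∧ ∀ k ∈ J, k ≠ j → A k y ≤ b k := by
  classical
  -- Working inside the affine hull removes implicit equalities from a minimal `J`, which covers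
  -- polyhedra that are not full-dimensional.
  obtain ⟨J, hJ, hmin⟩ := exists_minimal_of_wellFoundedLT (fun J : Finset (Fin p) =>
    ∀ x ∈ affineSpan ℝ {x | ∀ i, A i x ≤ b i}, (∀ j ∈ J, A j x ≤ b j) → ∀ i, A i x ≤ b i)
    ⟨Finset.univ, fun x _ h i => h i (Finset.mem_univ i)⟩
  refine ⟨J, hJ, fun j hj => ?_⟩
  by_contra! hcon
  have hle := hmin (y := J.erase j) (fun x hx h => by
    refine hJ x hx fun k hk => ?_
    by_cases hkj : k = j
    · subst hkj
      by_contra! hlt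
      obtain ⟨l, hl, hne, hlt'⟩ := hcon x hx hlt
      exact (h l (Finset.mem_erase.2 ⟨hne, hl⟩)).not_gt hlt'
    · exact h k (Finset.mem_erase.2 ⟨hkj, hk⟩)) (Finset.erase_subset _ _)
  exact Finset.notMem_erase j J (hle hj)

/-- Finitely many valid inequalities, each strict somewhere on a convex set, are simultaneously
strict at some point. -/
lemma Convex.exists_forall_lt {ι : Type*} {C : Set E} (hC : Convex ℝ C) (hne : C.Nonempty)
    (s : Finset ι) (A : ι → Module.Dual ℝ E) (b : ι → ℝ) (hle : ∀ i ∈ s, ∀ x ∈ C, A i x ≤ b i)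
    (hlt : ∀ i ∈ s, ∃ x ∈ C, A i x < b i) : ∃ x ∈ C, ∀ i ∈ s, A i x < b i := by
  classical
  induction s using Finset.induction_on with
  | empty => exact ⟨hne.some, hne.some_mem, by simp⟩
  | insert i s hi ih =>
    obtain ⟨x, hx, hxs⟩ := ih (fun k hk => hle k (Finset.mem_insert_of_mem hk))
      (fun k hk => hlt k (Finset.mem_insert_of_mem hk))
    obtain ⟨y, hy, hyi⟩ := hlt i (Finset.mem_insert_self i s)
    refine ⟨(1 / 2 : ℝ) • x + (1 / 2 : ℝ) • y,
      hC hx hy (by norm_num) (by norm_num) (by norm_num), fun k hk => ?_⟩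
    have hxk := hle k hk x hx
    have hyk := hle k hk y hy
    simp only [map_add, map_smul, smul_eq_mul]
    rcases Finset.mem_insert.1 hk with rfl | hk
    · linarith
    · linarith [hxs k hk]

lemma vectorSpan_le_ker {F : Set E} {f : Module.Dual ℝ E} {β : ℝ} (h : ∀ x ∈ F, f x = β) :
    vectorSpan ℝ F ≤ LinearMap.ker f := by
  rw [vectorSpan_def, Submodule.span_le]
  rintro _ ⟨x, hx, y, hy, rfl⟩
  simp [h x hx, h y hy]

lemma finrank_inf_ker_add_one [FiniteDimensional ℝ E] (W : Submodule ℝ E) (f : Module.Dual ℝ E)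
    {v : E} (hv : v ∈ W) (hfv : f v ≠ 0) :
    Module.finrank ℝ ↥(W ⊓ LinearMap.ker f) + 1 = Module.finrank ℝ W := by
  have hne : f.comp W.subtype ≠ 0 := fun h => hfv (by simpa using LinearMap.congr_fun h ⟨v, hv⟩)
  rw [← Module.Dual.finrank_ker_add_one_of_ne_zero hne, LinearMap.ker_comp,
    ← Submodule.map_comap_subtype, Submodule.finrank_map_subtype_eq]

/-- An inequality of an irredundant subsystem defines a facet. -/
lemma isFacet_of_irredundant [FiniteDimensional ℝ E] {Q : Set E} (hQ : Convex ℝ Q)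
    (hne : Q.Nonempty) {ι : Type*} (J : Finset ι) (A : ι → Module.Dual ℝ E) (b : ι → ℝ)
    (hJ : ∀ x ∈ affineSpan ℝ Q, (∀ j ∈ J, A j x ≤ b j) → x ∈ Q)
    (hJ' : ∀ x ∈ Q, ∀ j ∈ J, A j x ≤ b j)
    (hirr : ∀ j ∈ J, ∃ y ∈ affineSpan ℝ Q, b j < A j y ∧ ∀ k ∈ J, k ≠ j → A k y ≤ b k)
    {j : ι} (hj : j ∈ J) : IsFacet Q {x ∈ Q | A j x = b j} := by
  -- An inequality of `J` tight on all of `Q` would be tight on the affine hull, against its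
  -- violation there.
  obtain ⟨z, hz, hzlt⟩ := hQ.exists_forall_lt hne J A b (fun k hk x hx => hJ' x hx k hk) (by
    intro k hk
    by_contra! hcon
    obtain ⟨y, hy, hlt, -⟩ := hirr k hk
    obtain ⟨z, hz⟩ := hne
    have heq : ∀ x ∈ Q, A k x = b k := fun x hx => le_antisymm (hJ' x hx k hk) (hcon x hx)
    have hmem := AffineSubspace.vsub_mem_direction hy (subset_affineSpan ℝ Q hz)
    rw [direction_affineSpan] at hmem
    have := vectorSpan_le_ker heq hmem
    simp only [vsub_eq_sub, LinearMap.mem_ker, map_sub, heq z hz] at this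
    linarith)
  obtain ⟨y, hy, hylt, hyle⟩ := hirr j hj
  have hzS := subset_affineSpan ℝ Q hz
  have hzj := hzlt j hj
  have hpos : 0 < A j y - A j z := by linarith
  -- The segment from `z` to `y` crosses the hyperplane of `j` at parameter `t < 1`, where the other
  -- inequalities of `J` are still strict.
  set t := (b j - A j z) / (A j y - A j z) with ht
  have ht0 : 0 < t := div_pos (by linarith) hpos
  have ht1 : t < 1 := (div_lt_one hpos).2 (by linarith)
  have hAw : ∀ k, A k (AffineMap.lineMap z y t) = A k z + t * (A k y - A k z) := fun k => by
    simp [AffineMap.lineMap_apply, add_comm]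
  have hwj : A j (AffineMap.lineMap z y t) = b j := by
    rw [hAw, ht, div_mul_cancel₀ _ hpos.ne']
    ring
  set w := AffineMap.lineMap z y t with hw
  have hwS : w ∈ affineSpan ℝ Q := AffineMap.lineMap_mem t hzS hy
  have hwlt : ∀ k ∈ J, k ≠ j → A k w < b k := fun k hk hkj => by
    rw [hAw]
    nlinarith [hzlt k hk, hyle k hk hkj]
  have hwQ : w ∈ Q := hJ w hwS fun k hk => by
    by_cases hkj : k = j
    · rw [hkj, hwj]
    · exact (hwlt k hk hkj).le
  refine ⟨fun _ => ⟨(A j).toContinuousLinearMap, ?_⟩, ⟨w, hwQ, hwj⟩, ?_⟩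
  · ext x
    simp only [Set.mem_ofPred_eq, LinearMap.coe_toContinuousLinearMap']
    refine and_congr_right fun hx => ⟨fun h y hy => h ▸ hJ' y hy j hj, fun h => ?_⟩
    exact le_antisymm (hJ' x hx j hj) (hwj ▸ h w hwQ)
  · have hspan : vectorSpan ℝ {x ∈ Q | A j x = b j} = vectorSpan ℝ Q ⊓ LinearMap.ker (A j) := by
      refine le_antisymm (le_inf (vectorSpan_mono ℝ (Set.sep_subset _ _))
        (vectorSpan_le_ker fun x hx => hx.2)) ?_
      rintro v ⟨hvQ, hvk⟩
      have hvj : A j v = 0 := hvk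
      -- Only `j` is tight at `w`, so a short move along any direction of `Q` parallel to the
      -- hyperplane stays in the face.
      obtain ⟨ε, hε, h⟩ := exists_pos_forall_add_mul_le J (fun k => A k w) (fun k => A k v) b
        fun k hk => by
          by_cases hkj : k = j
          · subst hkj
            exact ⟨hwj.le, fun _ => hvj.le⟩
          · exact ⟨(hwlt k hk hkj).le, fun h => absurd h (hwlt k hk hkj).ne⟩
      have hmem : ε • v + w ∈ {x ∈ Q | A j x = b j} := by
        refine ⟨hJ _ ?_ fun k hk => ?_, by simp [hvj, hwj]⟩
        · refine AffineSubspace.vadd_mem_of_mem_direction ?_ hwS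
          rw [direction_affineSpan]
          exact Submodule.smul_mem _ _ hvQ
        · simpa [add_comm] using h k hk
      have := vsub_mem_vectorSpan ℝ hmem (show w ∈ {x ∈ Q | A j x = b j} from ⟨hwQ, hwj⟩)
      rw [vsub_eq_sub, add_sub_cancel_right] at this
      exact (Submodule.smul_mem_iff _ hε.ne').1 this
    rw [affDim, affDim, hspan]
    refine finrank_inf_ker_add_one _ _ (vsub_mem_vectorSpan ℝ hwQ hz) ?_
    rw [vsub_eq_sub, map_sub, hwj]
    linarith

/-- A point of a polyhedron outside a nonempty face is outside some facet containing the face. -/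
lemma exists_isFacet_of_lt [FiniteDimensional ℝ E] {p : ℕ} (A : Fin p → Module.Dual ℝ E)
    (b : Fin p → ℝ) (f : Module.Dual ℝ E) (β : ℝ) (hf : ∀ x, (∀ i, A i x ≤ b i) → f x ≤ β)
    {g q : E} (hg : ∀ i, A i g ≤ b i) (hfg : f g = β) (hq : ∀ i, A i q ≤ b i) (hfq : f q < β) :
    ∃ F, IsFacet {x | ∀ i, A i x ≤ b i} F ∧ (∀ x, (∀ i, A i x ≤ b i) → f x = β → x ∈ F) ∧
      q ∉ F := by
  classical
  obtain ⟨J, hJ, hirr⟩ := exists_irredundant A b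
  have hconv : Convex ℝ {x | ∀ i, A i x ≤ b i} := by
    simp only [Set.ofPred_forall]
    exact convex_iInter fun i => convex_halfSpace_le (A i).isLinear (b i)
  suffices h : ∃ j ∈ J, (∀ x, (∀ i, A i x ≤ b i) → f x = β → A j x = b j) ∧ A j q < b j by
    obtain ⟨j, hj, h1, h2⟩ := h
    exact ⟨{x ∈ {x | ∀ i, A i x ≤ b i} | A j x = b j},
      isFacet_of_irredundant hconv ⟨g, hg⟩ J A b hJ (fun x hx k _ => hx k) hirr hj,
      fun x hx hfx => ⟨hx, h1 x hx hfx⟩, fun h => h2.ne h.2⟩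
  -- Otherwise some `y` on the face is strict wherever `q` is. The ray from `q` through `y` then
  -- continues inside the polyhedron beyond `y`, where `f` exceeds `β`.
  by_contra! hcon
  obtain ⟨y, ⟨hy, hfy⟩, hylt⟩ :=
    (hconv.inter (convex_hyperplane f.isLinear β)).exists_forall_lt
      ⟨g, hg, hfg⟩ (J.filter fun j => A j q < b j) A b (fun i _ x hx => hx.1 i) (by
        intro j hj
        obtain ⟨hj, hlt⟩ := Finset.mem_filter.1 hj
        by_contra! h
        refine (hcon j hj fun x hx hfx => ?_).not_gt hlt
        exact le_antisymm (hx j) (h x ⟨hx, hfx⟩))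
  obtain ⟨ε, hε, h⟩ := exists_pos_forall_add_mul_le J (fun k => A k y) (fun k => A k y - A k q) b
    fun k hk => ⟨hy k, fun heq => by
      have : ¬ A k q < b k := fun hlt => (hylt k (Finset.mem_filter.2 ⟨hk, hlt⟩)).ne heq
      linarith⟩
  have hmem := hf (ε • (y - q) + y) (hJ _ (AffineSubspace.vadd_mem_of_mem_direction (by
      rw [direction_affineSpan]
      exact Submodule.smul_mem _ _ (vsub_mem_vectorSpan ℝ hy hq)) (subset_affineSpan ℝ _ hy))
    fun k hk => by simpa [add_comm] using h k hk)
  have hfy' : f y = β := hfy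
  simp only [map_add, map_smul, map_sub, smul_eq_mul, hfy'] at hmem
  have := mul_pos hε (sub_pos.2 hfq)
  linarith

end Polyhedra

/-! ### The lower bound on extension complexity. -/

/-- The rectangle covering bound for extension complexity, applied to a slack matrix with the
support pattern of unique disjointness. -/
lemma three_pow_le_polytopeSize_mul {E α : Type*} [NormedAddCommGroup E] [NormedSpace ℝ E]
    [FiniteDimensional ℝ E] [DecidableEq α] {R : Set E} {r : ℕ} {Q : Set (E × (Fin r → ℝ))}
    (hQ : IsExtension Q R) (U : Finset α) (f : Finset α → Module.Dual ℝ E) (β : ℝ)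
    (v : Finset α → E) (hf : ∀ A ⊆ U, ∀ x ∈ R, f A x ≤ β) (hf' : ∀ A ⊆ U, ∃ x ∈ R, f A x = β)
    (hv : ∀ B ⊆ U, v B ∈ R)
    (h1 : ∀ A ⊆ U, ∀ B ⊆ U, (A ∩ B).card = 1 → f A (v B) = β)
    (h0 : ∀ A ⊆ U, ∀ B ⊆ U, Disjoint A B → f A (v B) < β) :
    (3 ^ U.card : ℕ∞) ≤ polytopeSize Q * 2 ^ U.card := by
  obtain ⟨⟨-, p, A', b, hQ⟩, rfl⟩ := hQ
  have hmem : ∀ x, x ∈ Q ↔ ∀ i, A' i x ≤ b i := fun x => by rw [hQ]; rfl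
  by_cases hfin : {F : Set (E × (Fin r → ℝ)) | IsFacet Q F}.Finite
  · rw [polytopeSize, hfin.encard_eq_coe_toFinset_card]
    have := three_pow_le_card_mul_two_pow U hfin.toFinset
      (fun F A => ∀ x ∈ Q, f A x.1 = β → x ∈ F)
      (fun F B => ∃ y, (v B, y) ∈ Q ∧ (v B, y) ∉ F)
      (by
        rintro F - A hA B hB hP ⟨y, hy, hyF⟩ hAB
        exact hyF (hP _ hy (h1 A hA B hB hAB)))
      (by
        intro A hA B hB hd
        obtain ⟨x, ⟨z, hz⟩, hx⟩ := hf' A hA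
        obtain ⟨y, hy⟩ := hv B hB
        obtain ⟨F, hF, hGF, hyF⟩ := exists_isFacet_of_lt A' b
          ((f A).comp (LinearMap.fst ℝ E (Fin r → ℝ))) β
          (fun x hx => hf A hA x.1 ⟨x.2, (hmem _).2 hx⟩) ((hmem (x, z)).1 hz) hx
          ((hmem (v B, y)).1 hy) (h0 A hA B hB hd)
        rw [← hQ] at hF
        exact ⟨F, hfin.mem_toFinset.2 hF, fun x hx hfx => hGF x ((hmem x).1 hx) hfx, y, hy, hyF⟩)
    exact_mod_cast this
  · rw [polytopeSize, Set.encard_eq_top (Set.not_finite.1 hfin), ENat.top_mul (by simp)]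
    exact le_top

lemma two_rpow_half_le (m : ℕ) : (2 : ℝ) ^ ((m : ℝ) / 2) ≤ (3 / 2) ^ m := by
  have h : (2 : ℝ) ^ ((m : ℝ) / 2) = (√2) ^ m := by
    rw [Real.sqrt_eq_rpow, ← Real.rpow_mul_natCast (by norm_num)]
    congr 1
    ring
  rw [h]
  exact pow_le_pow_left₀ (by positivity) (Real.sqrt_le_iff.2 ⟨by norm_num, by norm_num⟩) m

/-- A QAP4 relaxation has extension complexity at least `2 ^ (n / 4)`. -/
lemma two_rpow_le_extensionComplexity {n : ℕ} (hn : 14 ≤ n) {R : Set (QAPSpace n)}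
    (hR : IsQAP4Relaxation R) :
    (2 : ℝ≥0∞) ^ (1 / 4 * (n : ℝ)) ≤ (extensionComplexity R : ℝ≥0∞) := by
  classical
  obtain ⟨-, hsub, hvalid⟩ := hR
  have hvert : ∀ σ : Equiv.Perm (Fin n), qapVertex σ ∈ R := fun σ =>
    hsub (subset_convexHull ℝ _ ⟨σ, rfl⟩)
  -- Seven elements are reserved: `A ∪ T` is always large enough for a QAP4 inequality, while for `B
  -- ⊆ Tᶜ` the complement has at least seven elements and `(A ∪ T) ∩ B = A ∩ B`.
  obtain ⟨T, -, hT⟩ := Finset.exists_subset_card_eq (s := (Finset.univ : Finset (Fin n))) (n := 7)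
    (by simp; omega)
  have hT7 : ∀ A : Finset (Fin n), 7 ≤ (A ∪ T).card := fun A =>
    hT ▸ Finset.card_le_card Finset.subset_union_right
  have hσ' : ∀ B : Finset (Fin n), ∃ σ : Equiv.Perm (Fin n),
      Bᶜ.card ≠ 1 → ∀ x, σ x = x ↔ x ∈ B := fun B => by
    by_cases hB : Bᶜ.card ≠ 1
    · obtain ⟨σ, h⟩ := exists_perm_fixedPoints B hB
      exact ⟨σ, fun _ => h⟩
    · exact ⟨1, fun h => absurd h hB⟩
  choose σ hσ using hσ'
  have hBT : ∀ B ⊆ Tᶜ, Bᶜ.card ≠ 1 := fun B hB => by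
    have := Finset.card_le_card (Finset.subset_compl_comm.1 hB)
    omega
  have hslack : ∀ A, ∀ B ⊆ Tᶜ, (QAP4.diag _ (hT7 A)).slack (qapVertex (σ B)) =
      (((A ∩ B).card : ℝ) - 1) * (((A ∩ B).card : ℝ) - 2) / 2 := fun A B hB => by
    rw [QAP4.slack_diag _ B _ (hσ B (hBT B hB)), Finset.union_inter_distrib_right,
      Finset.disjoint_iff_inter_eq_empty.1 (Finset.subset_compl_iff_disjoint_left.1 hB),
      Finset.union_empty]
  have hcard : Tᶜ.card = n - 7 := by rw [Finset.card_compl, hT, Fintype.card_fin]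
  -- Facet counts live in `ℕ∞`, so the real bound is rounded up.
  have key : ((⌈(2 : ℝ) ^ (1 / 4 * (n : ℝ))⌉₊ : ℕ) : ℕ∞) ≤ extensionComplexity R := by
    refine le_iInf fun r => le_iInf fun Q => le_iInf fun hQ => ?_
    have h3 := three_pow_le_polytopeSize_mul hQ Tᶜ
      (fun A => (QAP4.diag _ (hT7 A)).lhsLinear) 1 (fun B => qapVertex (σ B))
      (fun A _ x hx => hvalid _ x hx)
      (fun A _ => by
        -- The face is nonempty: fixing only one `t ∈ T` gives exactly one hit.
        obtain ⟨t, ht⟩ := Finset.card_pos.1 (by omega : 0 < T.card)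
        refine ⟨_, hvert (σ {t}), ?_⟩
        have h := QAP4.slack_diag _ {t} (hT7 A) (hσ {t} (by
          rw [Finset.card_compl, Fintype.card_fin, Finset.card_singleton]
          omega))
        rw [Finset.inter_singleton_of_mem (Finset.mem_union_right A ht), Finset.card_singleton] at h
        simp only [QAP4.slack] at h
        change QAP4.lhs _ _ = 1
        norm_num at h
        linarith)
      (fun B _ => hvert _)
      (fun A _ B hB h => by
        have h' := hslack A B hB
        rw [h] at h'
        simp only [QAP4.slack] at h'
        change QAP4.lhs _ _ = 1
        norm_num at h'
        linarith)
      (fun A _ B hB h => by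
        have h' := hslack A B hB
        rw [Finset.disjoint_iff_inter_eq_empty.1 h] at h'
        simp only [QAP4.slack] at h'
        change QAP4.lhs _ _ < 1
        norm_num at h'
        linarith)
    rw [hcard] at h3
    rcases eq_or_ne (polytopeSize Q) ⊤ with htop | htop
    · rw [htop]
      exact le_top
    · obtain ⟨k, hk⟩ := ENat.ne_top_iff_exists.1 htop
      rw [← hk] at h3 ⊢
      have h3' : 3 ^ (n - 7) ≤ k * 2 ^ (n - 7) := by exact_mod_cast h3
      have h3r : (3 : ℝ) ^ (n - 7) ≤ k * 2 ^ (n - 7) := by exact_mod_cast h3'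
      refine Nat.cast_le.2 (Nat.ceil_le.2 ?_)
      -- `n / 4 ≤ (n - 7) / 2` holds exactly when `14 ≤ n`.
      calc (2 : ℝ) ^ (1 / 4 * (n : ℝ)) ≤ 2 ^ (((n - 7 : ℕ) : ℝ) / 2) := by
            refine Real.rpow_le_rpow_of_exponent_le (by norm_num) ?_
            rw [Nat.cast_sub (by omega)]
            have : (14 : ℝ) ≤ n := by exact_mod_cast hn
            push_cast
            linarith
        _ ≤ (3 / 2) ^ (n - 7) := two_rpow_half_le _
        _ ≤ k := by
            rw [div_pow]
            exact (div_le_iff₀ (by positivity)).2 h3r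
  calc (2 : ℝ≥0∞) ^ (1 / 4 * (n : ℝ)) = ENNReal.ofReal (2 ^ (1 / 4 * (n : ℝ))) := by
        rw [← ENNReal.ofReal_rpow_of_pos (by norm_num), ENNReal.ofReal_ofNat]
    _ ≤ (⌈(2 : ℝ) ^ (1 / 4 * (n : ℝ))⌉₊ : ℝ≥0∞) := by
        rw [← ENNReal.ofReal_natCast]
        exact ENNReal.ofReal_le_ofReal (Nat.le_ceil _)
    _ ≤ _ := by
        rw [← ENat.toENNReal_coe]
        exact ENat.toENNReal_le.2 key

/-! ### Slack matrices with prescribed rows and columns. -/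

/-- A polytope has a description whose last inequalities and points are prescribed. -/
lemma IsPolytope.exists_description {E ι κ : Type*} [NormedAddCommGroup E] [NormedSpace ℝ E]
    [FiniteDimensional ℝ E] [Finite ι] [Finite κ] {R : Set E} (hR : IsPolytope R)
    (f : ι → Module.Dual ℝ E) (β : ι → ℝ) (hf : ∀ i, ∀ x ∈ R, f i x ≤ β i)
    (w : κ → E) (hw : ∀ k, w k ∈ R) :
    ∃ (D : PolytopeDescription R) (row : ι ↪ Fin D.p) (col : κ ↪ Fin D.q),
      (∀ i, D.A (row i) = f i) ∧ (∀ i, D.b (row i) = β i) ∧ ∀ k, D.v (col k) = w k := by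
  obtain ⟨q, v, hv⟩ := hR.exists_eq_convexHull
  obtain ⟨-, p, A, b, hA⟩ := hR
  obtain ⟨p', ⟨e⟩⟩ := Finite.exists_equiv_fin ι
  obtain ⟨q', ⟨e'⟩⟩ := Finite.exists_equiv_fin κ
  -- Each index receives its own appended copy, so `row` and `col` are injective even if `f` or `w`
  -- repeats values.
  refine ⟨⟨p + p', q + q', Fin.append A (f ∘ e.symm), Fin.append b (β ∘ e.symm),
    Fin.append v (w ∘ e'.symm), ?_, ?_⟩, e.toEmbedding.trans (Fin.natAddEmb p),
    e'.toEmbedding.trans (Fin.natAddEmb q), fun i => by simp, fun i => by simp, fun k => by simp⟩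
  · ext x
    refine ⟨fun hx i => ?_, fun hx => ?_⟩
    · induction i using Fin.addCases with
      | left i =>
        rw [Fin.append_left, Fin.append_left]
        rw [hA] at hx
        exact hx i
      | right i =>
        rw [Fin.append_right, Fin.append_right]
        exact hf _ x hx
    · rw [hA]
      intro i
      simpa using hx (Fin.castAdd p' i)
  · refine Set.Subset.antisymm ?_ (convexHull_min ?_ (hv ▸ convex_convexHull ℝ _))
    · conv_lhs => rw [hv]
      refine convexHull_mono ?_
      rintro _ ⟨i, rfl⟩
      exact ⟨Fin.castAdd q' i, Fin.append_left _ _ _⟩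
    · rintro _ ⟨i, rfl⟩
      induction i using Fin.addCases with
      | left i =>
        rw [Fin.append_left, hv]
        exact subset_convexHull ℝ _ ⟨i, rfl⟩
      | right i =>
        rw [Fin.append_right]
        exact hw _

lemma sum_mul_eq_card_inter {n : ℕ} (a b : Fin n → Fin 2) :
    ∑ i, ((a i : ℕ) : ℝ) * ((b i : ℕ) : ℝ) =
      (((Finset.univ.filter fun i => a i = 1) ∩ (Finset.univ.filter fun i => b i = 1)).card : ℝ) := by
  rw [← Finset.filter_and, Finset.card_filter, Nat.cast_sum]
  refine Finset.sum_congr rfl fun i _ => ?_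
  generalize a i = x
  generalize b i = y
  fin_cases x <;> fin_cases y <;> simp

theorem mainTheorem5 :
    (∃ c : ℝ, 0 < c ∧ ∃ n₀ : ℕ, ∀ n : ℕ, n₀ ≤ n → ∀ R : Set (QAPSpace n),
      IsQAP4Relaxation R →
        (2 : ℝ≥0∞) ^ (c * (n : ℝ)) ≤ (extensionComplexity R : ℝ≥0∞)) ∧
    (∀ (n : ℕ) (h : QAP4 n) (σ : Equiv.Perm (Fin n)),
      h.slack (qapVertex σ) = ((Ring.choose ((h.hits σ : ℤ) - 1) 2 : ℤ) : ℝ)) ∧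
    (∀ (n : ℕ) (R : Set (QAPSpace n)), IsQAP4Relaxation R →
      ∃ (D : PolytopeDescription R) (row : RowVec n ↪ Fin D.p) (col : ColVec n ↪ Fin D.q),
        (∀ a, ∃ h : QAP4 n, D.b (row a) = 1 ∧ ∀ Y, D.A (row a) Y = h.lhs Y) ∧
        (∀ b, ∃ σ : Equiv.Perm (Fin n), D.v (col b) = qapVertex σ) ∧
        D.slackMatrix.submatrix row col =
          (1 / 2 : ℝ) • (Nmat 1 n).submatrix Subtype.val Subtype.val) := by
  refine ⟨⟨1 / 4, by norm_num, 14, fun n hn R hR => two_rpow_le_extensionComplexity hn hR⟩,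
    fun n h σ => h.slack_qapVertex_eq_choose σ, fun n R ⟨hpoly, hsub, hvalid⟩ => ?_⟩
  -- The ones of `b` become the fixed points of `σ`; the condition on its zeros is what makes such a
  -- permutation exist.
  have hσ' : ∀ b : ColVec n, ∃ σ : Equiv.Perm (Fin n),
      ∀ x, σ x = x ↔ x ∈ Finset.univ.filter fun i => b.1 i = 1 := fun b => by
    refine exists_perm_fixedPoints _ ?_
    have : (Finset.univ.filter fun i => b.1 i = 1)ᶜ = Finset.univ.filter fun i => b.1 i = 0 := by
      ext i
      simp only [Finset.compl_filter, Finset.mem_filter, Finset.mem_univ, true_and]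
      generalize b.1 i = y
      fin_cases y <;> simp
    rw [this]
    exact b.2
  choose σ hσ using hσ'
  obtain ⟨D, row, col, hA, hb, hv⟩ := hpoly.exists_description
    (fun a : RowVec n => (QAP4.diag _ a.2).lhsLinear) (fun _ => 1) (fun a x hx => hvalid _ x hx)
    (fun b : ColVec n => qapVertex (σ b)) (fun b => hsub (subset_convexHull ℝ _ ⟨σ b, rfl⟩))
  refine ⟨D, row, col, fun a => ⟨QAP4.diag _ a.2, hb a, fun Y => by rw [hA]; rfl⟩,
    fun b => ⟨σ b, hv b⟩, ?_⟩
  ext a b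
  have h := QAP4.slack_diag _ _ a.2 (hσ b)
  simp only [Matrix.submatrix_apply, PolytopeDescription.slackMatrix, Matrix.of_apply,
    Matrix.smul_apply, smul_eq_mul, Nmat, sum_mul_eq_card_inter, hA, hb, hv]
  refine h.trans ?_
  push_cast
  ring
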